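/- Let $K\subset\mathbb{R}^3$ be a PL knot, that is, a simple closed polygon with finitely many edges, with a fixed orientation and numbered oriented edges $S_1,\dots,S_n$. For $\xi\in S^2$ let $p_\xi$ be the orthogonal projection with kernel $\mathbb{R}\xi$. Call $\xi$ good if every nonempty fibre of $p_\xi|_K$ is one point, or two points neither of which is a vertex. For good $\xi$, the Tait number $T_K(\xi)\in\mathbb{Z}$ is the sum of the signs of the (finitely many) double points of the diagram, the sign being $+1$ if, seen from the side of $\xi$, the oriented upper strand has to be turned counterclockwise to coincide with the lower one, and $-1$ otherwise; set $T_K(\xi)=0$ if $\xi$ is not good. The writhe is $Wr(K)=\frac{1}{4\pi}\iint_{S^2}T_K(\xi)\,d\xi$. Let $s_i\in S^2$ be the direction of $S_i$; the indicatrix of $K$ is $I=\Gamma\cup-\Gamma$, where $\Gamma$ is the union of the (shortest) arcs of great circle joining $s_i$ to $s_{i+1}$ ($i$ modulo $n$). Suppose that $K$ is a lattice knot: it is contained in the union of the edges of a cubic lattice, with arbitrary origin, arbitrary mesh $a>0$ and arbitrary orthonormal axes $b_1,b_2,b_3$. Then almost every $\xi\in S^2$ is good, $T_K$ is integrable on $S^2$,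 and (1) $4\cdot Wr(K)$ is an integer; (2) $I$ is contained in the union $C$ of the three great circles $\{\xi\in S^2 : \xi\cdot b_k=0\}$, $k=1,2,3$; the set $\{\xi\in S^2: \xi\cdot b_3>0\}\setminus C$ has exactly four connected components $A_1,\dots,A_4$, namely the open octants given by the signs of $\xi\cdot b_1$ and $\xi\cdot b_2$, and each of them has area $\frac{\pi}{2}$; (3) $T_K$ takes a constant value $T_K(A_i)$ on the good directions of each $A_i$, and $Wr(K)=\frac14\left(T_K(A_1)+T_K(A_2)+T_K(A_3)+T_K(A_4)\right)$. -/

import Mathlib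

open MeasureTheory Set
open scoped RealInnerProductSpace

noncomputable section

/-- Euclidean three-space. -/
abbrev E3 : Type := EuclideanSpace ℝ (Fin 3)

/-- The unit sphere of directions. -/
abbrev S2 : Type := Metric.sphere (0 : E3) 1

/-- The surface area measure of the unit sphere (total mass `4π`). -/
abbrev sphereArea : Measure S2 := (volume : Measure E3).toSphere

/-- The determinant of three vectors of `ℝ³`, that is `(u × v) · w`. -/
def triple (u v w : E3) : ℝ := Matrix.det (Matrix.of ![u.ofLp, v.ofLp, w.ofLp])

/-- The point at parameter `t` of the `i`-th edge of the closed polygon with vertices `v`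
(the addition in `Fin n` is cyclic). -/
def edgePoint {n : ℕ} [NeZero n] (v : Fin n → E3) (i : Fin n) (t : ℝ) : E3 :=
  v i + t • (v (i + 1) - v i)

/-- An oriented PL knot with `n` numbered vertices: a closed polygon whose parametrization, by the
circle obtained from `n` copies of `[0, 1)` put end to end, is injective. It is therefore a
homeomorphism from the circle onto a finite union of segments. -/
structure PLKnot (n : ℕ) [NeZero n] where
  vertex : Fin n → E3
  injective : Function.Injective
    (fun q : Fin n × Ico (0 : ℝ) 1 => edgePoint vertex q.1 (q.2 : ℝ))

namespace PLKnot

variable {n : ℕ} [NeZero n] (K : PLKnot n)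

/-- The point of the knot with parameter `q = (i, t)`: every point has exactly one parameter. -/
def point (q : Fin n × Ico (0 : ℝ) 1) : E3 := edgePoint K.vertex q.1 (q.2 : ℝ)

/-- The knot as a subset of space. -/
def carrier : Set E3 := range K.point

/-- The vector of the `i`-th oriented edge. -/
def edgeVec (i : Fin n) : E3 := K.vertex (i + 1) - K.vertex i

/-- The part of the knot that the orthogonal projection along `ξ` maps to `w`. -/
def fiber (ξ : S2) (w : (Submodule.span ℝ {(ξ : E3)})ᗮ) : Set E3 :=
  {x ∈ K.carrier | (Submodule.span ℝ {(ξ : E3)})ᗮ.orthogonalProjectionOnto x = w}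

/-- The projection along `ξ` is good: every fiber is empty, one point, or two points none of which
is a vertex. -/
def IsGood (ξ : S2) : Prop :=
  ∀ w : (Submodule.span ℝ {(ξ : E3)})ᗮ,
    K.fiber ξ w = ∅ ∨ (∃ x, K.fiber ξ w = {x}) ∨
      ∃ x y, x ≠ y ∧ x ∉ range K.vertex ∧ y ∉ range K.vertex ∧ K.fiber ξ w = {x, y}

/-- The double points of the diagram in direction `ξ`, each given by the parameters of its upper
and of its lower preimage. -/
def crossings (ξ : S2) : Set ((Fin n × Ico (0 : ℝ) 1) × (Fin n × Ico (0 : ℝ) 1)) :=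
  {c | (Submodule.span ℝ {(ξ : E3)})ᗮ.orthogonalProjectionOnto (K.point c.1) =
      (Submodule.span ℝ {(ξ : E3)})ᗮ.orthogonalProjectionOnto (K.point c.2) ∧
    ⟪(ξ : E3), K.point c.2⟫ < ⟪(ξ : E3), K.point c.1⟫}

/-- The sign of a double point: `+1` if, seen from the side of `ξ`, the upper strand has to be
turned counterclockwise to coincide with the lower one, and `-1` if clockwise. -/
def crossingSign (ξ : S2) (c : (Fin n × Ico (0 : ℝ) 1) × (Fin n × Ico (0 : ℝ) 1)) : ℤ :=
  (SignType.sign (triple (K.edgeVec c.1.1) (K.edgeVec c.2.1) (ξ : E3)) : ℤ)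

/-- The Tait number of the diagram in a good direction `ξ` (which has finitely many double
points). -/
def tait (ξ : S2) : ℤ := ∑ᶠ c ∈ K.crossings ξ, K.crossingSign ξ c

open Classical in
/-- The Tait number as a function on the sphere, set to `0` where the projection is not good. -/
def taitFun (ξ : S2) : ℝ := if K.IsGood ξ then (K.tait ξ : ℝ) else 0

/-- The writhe. -/
def writhe : ℝ := 1 / (4 * Real.pi) * ∫ ξ, K.taitFun ξ ∂sphereArea

/-- The direction of the `i`-th oriented edge, as a vector of norm one. -/
def edgeDir (i : Fin n) : E3 := ‖K.edgeVec i‖⁻¹ • K.edgeVec i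

/-- The arc of great circle that joins the direction of an edge to the direction of the next one
(these are never opposite). -/
def indicatrixArc (i : Fin n) : Set S2 :=
  {ξ | ∃ α β : ℝ, 0 ≤ α ∧ 0 ≤ β ∧ (ξ : E3) = α • K.edgeDir i + β • K.edgeDir (i + 1)}

/-- The set of points of the spherical indicatrix `Γ ∪ -Γ`, where `Γ` is the union of the arcs. -/
def indicatrix : Set S2 := {ξ | ∃ i, ξ ∈ K.indicatrixArc i ∨ -ξ ∈ K.indicatrixArc i}

end PLKnot

/-- The union of all edges of the cubic lattice with origin `o`, mesh `a` and axes `b`: all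
coordinates of a point, except possibly one, are integral multiples of the mesh. -/
def cubicGrid (o : E3) (a : ℝ) (b : OrthonormalBasis (Fin 3) ℝ E3) : Set E3 :=
  {x | ∃ k : Fin 3, ∀ j, j ≠ k → ∃ m : ℤ, ⟪b j, x - o⟫ = m * a}

/-- The union of the three great circles orthogonal to the axes `b`. -/
def axisCircles (b : OrthonormalBasis (Fin 3) ℝ E3) : Set S2 :=
  {ξ | ∃ k : Fin 3, ⟪b k, (ξ : E3)⟫ = 0}

/-- The open hemisphere centred at the last axis. -/
def hemisphere (b : OrthonormalBasis (Fin 3) ℝ E3) : Set S2 :=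
  {ξ | 0 < ⟪b 2, (ξ : E3)⟫}

/-- The four open octants of that hemisphere, indexed by two signs. -/
def octant (b : OrthonormalBasis (Fin 3) ℝ E3) (σ : ℤˣ × ℤˣ) : Set S2 :=
  {ξ | 0 < ⟪b 2, (ξ : E3)⟫ ∧ 0 < ((σ.1 : ℤ) : ℝ) * ⟪b 0, (ξ : E3)⟫ ∧
    0 < ((σ.2 : ℤ) : ℝ) * ⟪b 1, (ξ : E3)⟫}

end

/-! Inside an octant, divide the axis coordinates by those of ξ, so that ξ becomes (1,1,1). A
crossing is then a pair of points whose difference lies on the open diagonal ray. For edges i, j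
along different axes k, l, the differences form a parallelogram on which the third coordinate m is
constant. Its signed intersection with the ray is a mixed second difference of the indicator of "x_m
is positive and smallest" (`pairCoeff_mul_doubleDiff`).

This count still depends on ξ. But the three indicators add up to that of the positive octant, and
modulo the latter the weighted count is a difference of one term depending on the axis of i and one
depending on the axis of j. Such terms telescope around the closed polygon
(`sum_pairCoeff_mul_doubleDiff`). What remains sees only signs of coordinates, which positive
rescaling preserves, so the Tait number is constant on the octant (`tait_eq_of_mem_octant`).

Bad directions lie on finitely many planes and quadratic cones (`ae_isGood`). The Tait number is
even, and each octant together with its antipode has area π, so the writhe is the mean of four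
integers. -/

/-! ### Signed zeros of affine functions -/

/-- `H` agrees with the Heaviside function away from the origin. -/
def IsStep (H : ℝ → ℤ) : Prop := (∀ s, 0 < s → H s = 1) ∧ ∀ s, s < 0 → H s = 0

theorem IsStep.eq_of_no_zero {H : ℝ → ℤ} (hH : IsStep H) {x y : ℝ}
    (h : ∀ t ∈ Icc (0 : ℝ) 1, x + t * (y - x) ≠ 0) : H x = H y := by
  have hx : x ≠ 0 := by simpa using h 0 (by simp)
  have hy : y ≠ 0 := by simpa using h 1 (by simp)
  have key : ¬ x * y < 0 := by
    intro hxy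
    have hne : x - y ≠ 0 := fun h0 => by
      rw [sub_eq_zero.1 h0] at hxy
      exact absurd hxy (not_lt.2 (mul_self_nonneg y))
    refine h (x / (x - y)) ?_ (by field_simp; ring)
    rcases mul_neg_iff.1 hxy with ⟨h1, h2⟩ | ⟨h1, h2⟩
    · exact ⟨div_nonneg h1.le (by linarith), (div_le_one (by linarith)).2 (by linarith)⟩
    · exact ⟨div_nonneg_of_nonpos h1.le (by linarith),
        (div_le_one_of_neg (by linarith)).2 (by linarith)⟩
  rcases lt_or_gt_of_ne hx with h1 | h1 <;> rcases lt_or_gt_of_ne hy with h2 | h2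
  · rw [hH.2 _ h1, hH.2 _ h2]
  · exact absurd (mul_neg_of_neg_of_pos h1 h2) key
  · exact absurd (mul_neg_of_pos_of_neg h1 h2) key
  · rw [hH.1 _ h1, hH.1 _ h2]

/-- Nonzero end values force the zero into the interior, hence into the half-open parameter interval
of an edge; the value of `H` at 0 plays no role. -/
theorem IsStep.sub_eq_sign {H : ℝ → ℤ} (hH : IsStep H) {x y t : ℝ} (hx : x ≠ 0) (hy : y ≠ 0)
    (ht : t ∈ Icc (0 : ℝ) 1) (h : x + t * (y - x) = 0) :
    H y - H x = (SignType.sign (y - x) : ℤ) ∧ t < 1 := by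
  obtain ⟨h0, h1⟩ := ht
  have ht1 : t < 1 := lt_of_le_of_ne h1 fun h' => hy (by rw [h'] at h; linarith)
  refine ⟨?_, ht1⟩
  have h0' : 0 < t := lt_of_le_of_ne h0 fun h' => hx (by rw [← h'] at h; linarith)
  rcases lt_or_gt_of_ne hx with hx' | hx'
  · have hy' : 0 < y := by nlinarith
    rw [hH.1 _ hy', hH.2 _ hx', sign_pos (by linarith)]; rfl
  · have hy' : y < 0 := by nlinarith
    rw [hH.2 _ hy', hH.1 _ hx', sign_neg (by linarith)]; rfl

open Classical in
/-- The signed common zero of two affine functions of independent parameters, as a product of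
differences of step functions. -/
theorem IsStep.mul_sub_eq {H H' : ℝ → ℤ} (hH : IsStep H) (hH' : IsStep H') {x y x' y' : ℝ}
    (h : ∀ t' ∈ Icc (0 : ℝ) 1, x' + t' * (y' - x') = 0 → x ≠ 0 ∧ y ≠ 0)
    (h' : ∀ t ∈ Icc (0 : ℝ) 1, x + t * (y - x) = 0 → x' ≠ 0 ∧ y' ≠ 0) :
    (H y - H x) * (H' y' - H' x') =
      if (∃ t ∈ Ico (0 : ℝ) 1, x + t * (y - x) = 0) ∧
        ∃ t' ∈ Ico (0 : ℝ) 1, x' + t' * (y' - x') = 0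
      then (SignType.sign (y - x) : ℤ) * (SignType.sign (y' - x') : ℤ) else 0 := by
  by_cases hz : ∃ t ∈ Icc (0 : ℝ) 1, x + t * (y - x) = 0
  · by_cases hz' : ∃ t' ∈ Icc (0 : ℝ) 1, x' + t' * (y' - x') = 0
    -- A zero of either function makes the end values of the other nonzero, so both jumps are
    -- genuine sign changes.
    · obtain ⟨t, ht, hxt⟩ := hz
      obtain ⟨t', ht', hxt'⟩ := hz'
      have h1 := hH.sub_eq_sign (h t' ht' hxt').1 (h t' ht' hxt').2 ht hxt
      have h2 := hH'.sub_eq_sign (h' t ht hxt).1 (h' t ht hxt).2 ht' hxt'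
      rw [if_pos ⟨⟨t, ⟨ht.1, h1.2⟩, hxt⟩, t', ⟨ht'.1, h2.2⟩, hxt'⟩, h1.1, h2.1]
    · rw [if_neg fun hc => hz' (hc.2.imp fun t ht => ⟨Ico_subset_Icc_self ht.1, ht.2⟩),
        hH'.eq_of_no_zero fun t ht h0 => hz' ⟨t, ht, h0⟩]
      simp
  · rw [if_neg fun hc => hz (hc.1.imp fun t ht => ⟨Ico_subset_Icc_self ht.1, ht.2⟩),
      hH.eq_of_no_zero fun t ht h0 => hz ⟨t, ht, h0⟩]
    simp

/-! ### Counting functions of the coordinate rays -/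

open Classical in
/-- The indicator of the vectors whose coordinate with index `m` is positive and the smallest, the
first of the smallest ones if there are several. -/
noncomputable def minIndicator (m : Fin 3) (x : Fin 3 → ℝ) : ℤ :=
  if 0 < x m ∧ ∀ r, r ≠ m → x m < x r ∨ (x m = x r ∧ m < r) then 1 else 0

open Classical in
/-- The indicator of the positive octant. -/
noncomputable def posIndicator (x : Fin 3 → ℝ) : ℤ := if ∀ m, 0 < x m then 1 else 0

/-- The tie rule selects exactly one smallest coordinate, so the identity also holds when
coordinates coincide, which differences of vertices may do. -/
theorem sum_minIndicator (x : Fin 3 → ℝ) :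
    minIndicator 0 x + minIndicator 1 x + minIndicator 2 x = posIndicator x := by
  simp only [minIndicator, posIndicator, Fin.forall_fin_succ]
  simp
  grind

/-- The step function used to compare the coordinates with indices `m` and `r`. -/
noncomputable def tieStep (m r : Fin 3) (s : ℝ) : ℤ :=
  open Classical in if 0 < s ∨ (s = 0 ∧ m < r) then 1 else 0

theorem isStep_tieStep (m r : Fin 3) : IsStep (tieStep m r) := by
  refine ⟨fun s hs => by simp [tieStep, hs], fun s hs => ?_⟩
  simp [tieStep, hs.ne, hs.le]

/-- On a pair of edges along axes k and l, each step function involves the parameter of one edge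
only, so the double difference factors into two single differences. -/
theorem minIndicator_eq {m k l : Fin 3} (h1 : m ≠ k) (h2 : m ≠ l) (h3 : k ≠ l)
    (x : Fin 3 → ℝ) :
    minIndicator m x =
      if 0 < x m then tieStep m k (x k - x m) * tieStep m l (x l - x m) else 0 := by
  have hr : (∀ r, r ≠ m → x m < x r ∨ (x m = x r ∧ m < r)) ↔
      (x m < x k ∨ (x m = x k ∧ m < k)) ∧ (x m < x l ∨ (x m = x l ∧ m < l)) := by
    refine ⟨fun h => ⟨h k h1.symm, h l h2.symm⟩, fun h r hr => ?_⟩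
    have : r = k ∨ r = l := by omega
    rcases this with rfl | rfl
    exacts [h.1, h.2]
  simp only [minIndicator, tieStep, hr, sub_pos, sub_eq_zero]
  grind

/-- The type of a pair of coordinate directions: `-1` for a cyclic successor, `1` for a cyclic
predecessor, `0` for equal directions. -/
def pairCoeff (k l : Fin 3) : ℤ := if l = k + 1 then -1 else if k = l + 1 then 1 else 0

/-- The index different from `k` and `l`. -/
def thirdIndex (k l : Fin 3) : Fin 3 := -(k + l)

theorem thirdIndex_ne (k l : Fin 3) (h : k ≠ l) :
    thirdIndex k l ≠ k ∧ thirdIndex k l ≠ l := by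
  revert k l; decide

/-- The potential of the coordinate direction `k`. -/
noncomputable def potential (k : Fin 3) (x : Fin 3 → ℝ) : ℤ :=
  if k = 0 then 0 else if k = 1 then minIndicator 2 x else -minIndicator 1 x

/-- The pairs of directions whose count is not a difference of potentials. -/
def residueCoeff (k l : Fin 3) : ℤ :=
  if k = 1 ∧ l = 2 then -1 else if k = 2 ∧ l = 1 then 1 else 0

/-- Pairs containing 0 are settled by the choice of `potential`; for the pair 1, 2 the third
indicator is the positive-octant indicator minus the other two. -/
theorem pairCoeff_mul_minIndicator (k l : Fin 3) (x : Fin 3 → ℝ) :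
    pairCoeff k l * minIndicator (thirdIndex k l) x =
      potential k x - potential l x + residueCoeff k l * posIndicator x := by
  rw [← sum_minIndicator]
  have h01 : thirdIndex 0 1 = 2 := by decide
  have h10 : thirdIndex 1 0 = 2 := by decide
  have h02 : thirdIndex 0 2 = 1 := by decide
  have h20 : thirdIndex 2 0 = 1 := by decide
  have h12 : thirdIndex 1 2 = 0 := by decide
  have h21 : thirdIndex 2 1 = 0 := by decide
  fin_cases k <;> fin_cases l <;>
    simp [pairCoeff, potential, residueCoeff, h01, h10, h02, h20, h12, h21] <;> ring

/-- The double difference of a function over a pair of edges of a closed polygon. -/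
def doubleDiff {n : ℕ} [NeZero n] (F : (Fin 3 → ℝ) → ℤ) (p : Fin n → Fin 3 → ℝ) (i j : Fin n) :
    ℤ :=
  F (p (i + 1) - p (j + 1)) - F (p (i + 1) - p j) - F (p i - p (j + 1)) + F (p i - p j)

theorem sum_shift {n : ℕ} [NeZero n] (f : Fin n → ℤ) : ∑ i, f (i + 1) = ∑ i, f i :=
  Equiv.sum_comp (Equiv.addRight (1 : Fin n)) f

/-- The signed count over all pairs of edges only depends on the indicator of the octant. -/
theorem sum_pairCoeff_mul_doubleDiff {n : ℕ} [NeZero n] (κ : Fin n → Fin 3)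
    (p : Fin n → Fin 3 → ℝ) :
    ∑ i, ∑ j, pairCoeff (κ i) (κ j) * doubleDiff (minIndicator (thirdIndex (κ i) (κ j))) p i j =
      ∑ i, ∑ j, residueCoeff (κ i) (κ j) * doubleDiff posIndicator p i j := by
  have h : ∀ i j, pairCoeff (κ i) (κ j) *
      doubleDiff (minIndicator (thirdIndex (κ i) (κ j))) p i j =
      doubleDiff (potential (κ i)) p i j - doubleDiff (potential (κ j)) p i j +
        residueCoeff (κ i) (κ j) * doubleDiff posIndicator p i j := by
    intro i j
    simp only [doubleDiff, mul_add, mul_sub, pairCoeff_mul_minIndicator]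
    ring
  -- For fixed i the function does not vary with j, so its differences cancel around the closed
  -- polygon.
  have h1 : ∑ i, ∑ j, doubleDiff (potential (κ i)) p i j = 0 := by
    refine Finset.sum_eq_zero fun i _ => ?_
    simp only [doubleDiff, Finset.sum_add_distrib, Finset.sum_sub_distrib]
    rw [sum_shift fun j => potential (κ i) (p (i + 1) - p j),
      sum_shift fun j => potential (κ i) (p i - p j)]
    ring
  have h2 : ∑ i, ∑ j, doubleDiff (potential (κ j)) p i j = 0 := by
    rw [Finset.sum_comm]
    refine Finset.sum_eq_zero fun j _ => ?_
    simp only [doubleDiff, Finset.sum_add_distrib, Finset.sum_sub_distrib]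
    rw [sum_shift fun i => potential (κ j) (p i - p (j + 1)),
      sum_shift fun i => potential (κ j) (p i - p j)]
    ring
  simp only [h, Finset.sum_add_distrib, Finset.sum_sub_distrib, h1, h2]
  ring

/-! ### Fibres of the projection, crossings and their symmetry under ξ ↦ -ξ -/

theorem orthogonalProjectionOnto_eq_iff (ξ : S2) (x y : E3) :
    (Submodule.span ℝ {(ξ : E3)})ᗮ.orthogonalProjectionOnto x =
      (Submodule.span ℝ {(ξ : E3)})ᗮ.orthogonalProjectionOnto y ↔ ∃ r : ℝ, x - y = r • (ξ : E3) := by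
  rw [← sub_eq_zero, ← map_sub, Submodule.orthogonalProjectionOnto_eq_zero_iff,
    Submodule.orthogonal_orthogonal, Submodule.mem_span_singleton]
  simp only [eq_comm]

theorem real_inner_smul_self (ξ : S2) (r : ℝ) : ⟪(ξ : E3), r • (ξ : E3)⟫ = r := by
  rw [real_inner_smul_right, real_inner_self_eq_norm_sq, norm_eq_of_mem_sphere]; simp

theorem edgePoint_one {n : ℕ} [NeZero n] (v : Fin n → E3) (i : Fin n) :
    edgePoint v i 1 = v (i + 1) := by simp [edgePoint]

theorem edgePoint_zero {n : ℕ} [NeZero n] (v : Fin n → E3) (i : Fin n) :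
    edgePoint v i 0 = v i := by simp [edgePoint]

namespace PLKnot

variable {n : ℕ} [NeZero n] (K : PLKnot n)

theorem edgePoint_mem_carrier (i : Fin n) {t : ℝ} (ht : t ∈ Icc (0 : ℝ) 1) :
    edgePoint K.vertex i t ∈ K.carrier := by
  rcases eq_or_lt_of_le ht.2 with rfl | h
  · exact ⟨(i + 1, ⟨0, by simp⟩), by simp [point, edgePoint_one, edgePoint_zero]⟩
  · exact ⟨(i, ⟨t, ht.1, h⟩), rfl⟩

theorem vertex_mem_carrier (i : Fin n) : K.vertex i ∈ K.carrier :=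
  edgePoint_zero K.vertex i ▸ K.edgePoint_mem_carrier i (by simp)

theorem edgeVec_ne_zero (i : Fin n) : K.edgeVec i ≠ 0 := by
  intro h
  have := @K.injective (i, ⟨0, by norm_num⟩) (i, ⟨1 / 2, by norm_num⟩)
    (by simp only [edgePoint]; rw [show K.vertex (i + 1) - K.vertex i = 0 from h]; simp)
  simp [Subtype.ext_iff] at this

theorem mem_crossings_iff (ξ : S2) (c : (Fin n × Ico (0 : ℝ) 1) × (Fin n × Ico (0 : ℝ) 1)) :
    c ∈ K.crossings ξ ↔ ∃ r : ℝ, 0 < r ∧ K.point c.1 - K.point c.2 = r • (ξ : E3) := by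
  simp only [crossings, mem_ofPred_eq, orthogonalProjectionOnto_eq_iff]
  constructor
  · rintro ⟨⟨r, hr⟩, h⟩
    refine ⟨r, ?_, hr⟩
    have := congrArg (fun z => ⟪(ξ : E3), z⟫) hr
    simp only [real_inner_smul_self, inner_sub_right] at this
    linarith
  · rintro ⟨r, h, hr⟩
    refine ⟨⟨r, hr⟩, ?_⟩
    have := congrArg (fun z => ⟪(ξ : E3), z⟫) hr
    simp only [real_inner_smul_self, inner_sub_right] at this
    linarith

/-- No vertex has the same projection along `ξ` as another point of the knot. -/
def IsVertexFree (ξ : S2) : Prop :=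
  ∀ i, ∀ x ∈ K.carrier, (∃ r : ℝ, x - K.vertex i = r • (ξ : E3)) → x = K.vertex i

theorem IsGood.isVertexFree {K : PLKnot n} {ξ : S2} (h : K.IsGood ξ) : K.IsVertexFree ξ := by
  intro i x hx hr
  have hv : K.vertex i ∈ K.fiber ξ
      ((Submodule.span ℝ {(ξ : E3)})ᗮ.orthogonalProjectionOnto (K.vertex i)) :=
    ⟨K.vertex_mem_carrier i, rfl⟩
  have hx : x ∈ K.fiber ξ
      ((Submodule.span ℝ {(ξ : E3)})ᗮ.orthogonalProjectionOnto (K.vertex i)) :=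
    ⟨hx, (orthogonalProjectionOnto_eq_iff ξ _ _).2 hr⟩
  rcases h ((Submodule.span ℝ {(ξ : E3)})ᗮ.orthogonalProjectionOnto (K.vertex i)) with
    h | ⟨y, h⟩ | ⟨y, z, -, hy, hz, h⟩
  · rw [h] at hv; exact hv.elim
  · rw [h] at hv hx; rw [hv, hx]
  · rw [h] at hv
    rcases hv with hv | hv
    · exact (hy ⟨i, hv⟩).elim
    · exact (hz ⟨i, hv⟩).elim

theorem IsVertexFree.neg {K : PLKnot n} {ξ : S2} (h : K.IsVertexFree ξ) :
    K.IsVertexFree (-ξ) := by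
  rintro i x hx ⟨r, hr⟩
  exact h i x hx ⟨-r, by simpa using hr⟩

theorem isGood_of_not_triple {ξ : S2} (h : K.IsVertexFree ξ)
    (h3 : ∀ x ∈ K.carrier, ∀ y ∈ K.carrier, ∀ z ∈ K.carrier, x ≠ y → x ≠ z → y ≠ z →
      (∃ r : ℝ, y - x = r • (ξ : E3)) → (∃ r : ℝ, z - x = r • (ξ : E3)) → False) :
    K.IsGood ξ := by
  intro w
  rcases (K.fiber ξ w).eq_empty_or_nonempty with h0 | ⟨x, hx⟩
  · exact Or.inl h0
  refine Or.inr ?_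
  by_cases h1 : ∃ y ∈ K.fiber ξ w, y ≠ x
  · obtain ⟨y, hy, hne⟩ := h1
    have hyx : ∃ r : ℝ, y - x = r • (ξ : E3) :=
      (orthogonalProjectionOnto_eq_iff ξ _ _).1 (hy.2.trans hx.2.symm)
    refine Or.inr ⟨x, y, hne.symm, ?_, ?_, ?_⟩
    · rintro ⟨i, rfl⟩
      exact hne (h i y hy.1 hyx)
    · rintro ⟨i, rfl⟩
      exact hne.symm (h i x hx.1
        ((orthogonalProjectionOnto_eq_iff ξ _ _).1 (hx.2.trans hy.2.symm)))
    · refine Subset.antisymm (fun z hz => ?_) (by rintro z (rfl | rfl) <;> assumption)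
      by_contra hzn
      simp only [mem_insert_iff, mem_singleton_iff, not_or] at hzn
      exact h3 x hx.1 y hy.1 z hz.1 hne.symm (Ne.symm hzn.1) (Ne.symm hzn.2) hyx
        ((orthogonalProjectionOnto_eq_iff ξ _ _).1 (hz.2.trans hx.2.symm))
  · push Not at h1
    exact Or.inl ⟨x, Subset.antisymm h1 (by rintro z rfl; exact hx)⟩

/-- The upper and lower strands trade places, and the determinant changes sign twice: by the
exchange and by -ξ. -/
theorem tait_neg (ξ : S2) : K.tait (-ξ) = K.tait ξ := by
  refine finsum_mem_eq_of_bijOn Prod.swap ⟨?_, Prod.swap_injective.injOn, ?_⟩ ?_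
  · intro c hc
    rw [mem_crossings_iff] at hc ⊢
    obtain ⟨r, hr, h⟩ := hc
    refine ⟨r, hr, ?_⟩
    simp only [Prod.fst_swap, Prod.snd_swap]
    rw [← neg_sub, h]; simp
  · intro c hc
    rw [mem_crossings_iff] at hc
    obtain ⟨r, hr, h⟩ := hc
    refine ⟨c.swap, (K.mem_crossings_iff _ _).2 ⟨r, hr, ?_⟩, c.swap_swap⟩
    simp only [Prod.fst_swap, Prod.snd_swap]
    rw [← neg_sub, h]; simp
  · intro c _
    simp only [crossingSign, Prod.fst_swap, Prod.snd_swap]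
    congr 2
    simp [triple, Matrix.det_fin_three]
    ring

/-! ### The Tait number in coordinates adapted to the direction -/

section Coordinates

variable {K} {ξ : S2} {a : Fin 3 → E3 →ₗ[ℝ] ℝ} {D : ℝ} {κ : Fin n → Fin 3}

theorem mem_crossings_iff_coord (haξ : ∀ k, a k ξ = 1) (hinj : ∀ x, (∀ k, a k x = 0) → x = 0)
    (c : (Fin n × Ico (0 : ℝ) 1) × (Fin n × Ico (0 : ℝ) 1)) :
    c ∈ K.crossings ξ ↔ ∃ r : ℝ, 0 < r ∧ ∀ k, a k (K.point c.1) - a k (K.point c.2) = r := by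
  rw [mem_crossings_iff]
  refine exists_congr fun r => and_congr_right fun _ => ⟨fun h k => ?_, fun h => ?_⟩
  · rw [← map_sub, h, map_smul, haξ, smul_eq_mul, mul_one]
  · rw [← sub_eq_zero]
    refine hinj _ fun k => ?_
    rw [map_sub, map_smul, haξ, map_sub, h k]; simp

theorem IsVertexFree.coord_false (hv : K.IsVertexFree ξ) (haξ : ∀ k, a k ξ = 1)
    (hinj : ∀ x, (∀ k, a k x = 0) → x = 0) (i j : Fin n) {t : ℝ} (ht : t ∈ Icc (0 : ℝ) 1) {r : ℝ}
    (hr : r ≠ 0) (h : ∀ k, a k (edgePoint K.vertex j t) - a k (K.vertex i) = r) : False := by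
  have h1 := hv i _ (K.edgePoint_mem_carrier j ht) ⟨r, by
    rw [← sub_eq_zero]
    refine hinj _ fun k => ?_
    rw [map_sub, map_smul, haξ, map_sub, h k]; simp⟩
  have h2 := h 0
  rw [h1, sub_self] at h2
  exact hr h2.symm

theorem coord_edgePoint (a : Fin 3 → E3 →ₗ[ℝ] ℝ) (v : Fin n → E3) (i : Fin n) (t : ℝ)
    (k : Fin 3) :
    a k (edgePoint v i t) = a k (v i) + t * (a k (v (i + 1)) - a k (v i)) := by
  simp [edgePoint]


/-- Coordinate m is constant on both edges and so gives the height difference; the coordinates along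
the two edges then determine t and u separately. -/
theorem hit_iff (haξ : ∀ k, a k ξ = 1) (hinj : ∀ x, (∀ k, a k x = 0) → x = 0)
    (hκ : ∀ i k, k ≠ κ i → a k (K.vertex (i + 1)) = a k (K.vertex i)) {i j : Fin n} {m : Fin 3}
    (hij : κ i ≠ κ j) (h1 : m ≠ κ i) (h2 : m ≠ κ j) (t u : Ico (0 : ℝ) 1) :
    ((i, t), (j, u)) ∈ K.crossings ξ ↔ 0 < a m (K.vertex i) - a m (K.vertex j) ∧
      a (κ i) (K.vertex i) - a (κ i) (K.vertex j) - (a m (K.vertex i) - a m (K.vertex j)) +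
        t * (a (κ i) (K.vertex (i + 1)) - a (κ i) (K.vertex i)) = 0 ∧
      a (κ j) (K.vertex i) - a (κ j) (K.vertex j) - (a m (K.vertex i) - a m (K.vertex j)) +
        u * -(a (κ j) (K.vertex (j + 1)) - a (κ j) (K.vertex j)) = 0 := by
  rw [mem_crossings_iff_coord haξ hinj]
  have hk : ∀ k, k = m ∨ k = κ i ∨ k = κ j := fun k => by omega
  have e1 := hκ i m h1
  have e2 := hκ j m h2
  have e3 := hκ i (κ j) hij.symm
  have e4 := hκ j (κ i) hij
  simp only [point, coord_edgePoint]
  constructor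
  · rintro ⟨r, hr, h⟩
    have hm := h m
    have hi := h (κ i)
    have hj := h (κ j)
    rw [e1, e2, sub_self, sub_self] at hm
    rw [e4, sub_self] at hi
    rw [e3, sub_self] at hj
    exact ⟨by linarith, by linarith, by linarith⟩
  · rintro ⟨h0, hi, hj⟩
    refine ⟨_, h0, fun k => ?_⟩
    rcases hk k with rfl | rfl | rfl
    · rw [e1, e2]; ring
    · rw [e4]; linarith
    · rw [e3]; linarith

open Classical in
/-- The signed count of the crossings of two edges with different directions. -/
theorem pairCoeff_mul_doubleDiff (hv : K.IsVertexFree ξ) (haξ : ∀ k, a k ξ = 1)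
    (hinj : ∀ x, (∀ k, a k x = 0) → x = 0)
    (hκ : ∀ i k, k ≠ κ i → a k (K.vertex (i + 1)) = a k (K.vertex i)) {i j : Fin n}
    (hij : κ i ≠ κ j) :
    doubleDiff (minIndicator (thirdIndex (κ i) (κ j))) (fun i k => a k (K.vertex i)) i j =
      if ∃ t u, ((i, t), (j, u)) ∈ K.crossings ξ then
        -((SignType.sign (a (κ i) (K.edgeVec i)) : ℤ) * (SignType.sign (a (κ j) (K.edgeVec j)) : ℤ))
      else 0 := by
  obtain ⟨h1, h2⟩ := thirdIndex_ne _ _ hij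
  set m := thirdIndex (κ i) (κ j)
  have hk : ∀ k, k = m ∨ k = κ i ∨ k = κ j := fun k => by omega
  have e1 := hκ i m h1
  have e2 := hκ j m h2
  have e3 := hκ i (κ j) hij.symm
  have e4 := hκ j (κ i) hij
  have hex : (∃ t u, ((i, t), (j, u)) ∈ K.crossings ξ) ↔
      0 < a m (K.vertex i) - a m (K.vertex j) ∧
      (∃ t ∈ Ico (0 : ℝ) 1, a (κ i) (K.vertex i) - a (κ i) (K.vertex j) -
        (a m (K.vertex i) - a m (K.vertex j)) +
        t * (a (κ i) (K.vertex (i + 1)) - a (κ i) (K.vertex i)) = 0) ∧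
      ∃ u ∈ Ico (0 : ℝ) 1, a (κ j) (K.vertex i) - a (κ j) (K.vertex j) -
        (a m (K.vertex i) - a m (K.vertex j)) +
        u * -(a (κ j) (K.vertex (j + 1)) - a (κ j) (K.vertex j)) = 0 := by
    simp only [hit_iff haξ hinj hκ hij h1 h2]
    constructor
    · rintro ⟨t, u, h0, ht, hu⟩
      exact ⟨h0, ⟨t, t.2, ht⟩, u, u.2, hu⟩
    · rintro ⟨h0, ⟨t, ht, ht'⟩, u, hu, hu'⟩
      exact ⟨⟨t, ht⟩, ⟨u, hu⟩, h0, ht', hu'⟩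
  simp only [hex]
  simp only [doubleDiff, minIndicator_eq h1 h2 hij, Pi.sub_apply, e1, e2, e3, e4]
  by_cases h0 : 0 < a m (K.vertex i) - a m (K.vertex j)
  swap
  · simp [h0]
  simp only [h0, if_true, true_and]
  have key := (isStep_tieStep m (κ i)).mul_sub_eq (isStep_tieStep m (κ j))
    (x := a (κ i) (K.vertex i) - a (κ i) (K.vertex j) - (a m (K.vertex i) - a m (K.vertex j)))
    (y := a (κ i) (K.vertex (i + 1)) - a (κ i) (K.vertex j) -
      (a m (K.vertex i) - a m (K.vertex j)))
    (x' := a (κ j) (K.vertex i) - a (κ j) (K.vertex j) - (a m (K.vertex i) - a m (K.vertex j)))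
    (y' := a (κ j) (K.vertex i) - a (κ j) (K.vertex (j + 1)) -
      (a m (K.vertex i) - a m (K.vertex j))) ?_ ?_
  · simp only [sub_sub_sub_cancel_right, sub_sub_sub_cancel_left] at key
    -- The lower edge enters the difference negatively, whence the minus sign in the count.
    have e5 : a (κ j) (K.vertex j) - a (κ j) (K.vertex (j + 1)) =
      -(a (κ j) (K.vertex (j + 1)) - a (κ j) (K.vertex j)) := by ring
    rw [e5] at key
    have e6 : a (κ i) (K.edgeVec i) = a (κ i) (K.vertex (i + 1)) - a (κ i) (K.vertex i) := by
      simp [edgeVec]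
    have e7 : a (κ j) (K.edgeVec j) = a (κ j) (K.vertex (j + 1)) - a (κ j) (K.vertex j) := by
      simp [edgeVec]
    rw [e6, e7]
    have e8 : (SignType.sign (-(a (κ j) (K.vertex (j + 1)) - a (κ j) (K.vertex j))) : ℤ) =
        -(SignType.sign (a (κ j) (K.vertex (j + 1)) - a (κ j) (K.vertex j)) : ℤ) := by
      rw [Left.sign_neg, SignType.coe_neg]
    rw [e8, mul_neg] at key
    rw [← key]
    ring
  -- A zero at an end would place a vertex of one edge in line with a point of the other at a
  -- nonzero height difference, against `hv`; likewise in the second case.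
  · intro u hu hu0
    constructor
    · intro hc
      refine hv.coord_false haξ hinj i j hu (neg_ne_zero.2 h0.ne') fun k => ?_
      rw [coord_edgePoint]
      rcases hk k with rfl | rfl | rfl
      · rw [e2]; ring
      · rw [e4]; linarith
      · linarith
    · intro hc
      refine hv.coord_false haξ hinj (i + 1) j hu (neg_ne_zero.2 h0.ne') fun k => ?_
      rw [coord_edgePoint]
      rcases hk k with rfl | rfl | rfl
      · rw [e2, e1]; ring
      · rw [e4]; linarith
      · rw [e3]; linarith
  · intro t ht ht0
    constructor
    · intro hc
      refine hv.coord_false haξ hinj j i ht h0.ne' fun k => ?_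
      rw [coord_edgePoint]
      rcases hk k with rfl | rfl | rfl
      · rw [e1]; ring
      · linarith
      · rw [e3]; linarith
    · intro hc
      refine hv.coord_false haξ hinj (j + 1) i ht h0.ne' fun k => ?_
      rw [coord_edgePoint]
      rcases hk k with rfl | rfl | rfl
      · rw [e1, e2]; ring
      · rw [e4]; linarith
      · rw [e3]; linarith

/-- With ξ = (1,1,1) and edge vectors along coordinate axes, at most one term of the determinant
survives. -/
theorem sign_triple_edgeVec (haξ : ∀ k, a k ξ = 1)
    (hD : ∀ u v w, triple u v w = D * (a 0 u * (a 1 v * a 2 w - a 2 v * a 1 w) -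
      a 1 u * (a 0 v * a 2 w - a 2 v * a 0 w) + a 2 u * (a 0 v * a 1 w - a 1 v * a 0 w)))
    {k l : Fin 3} {u v : E3} (hu : ∀ r, r ≠ k → a r u = 0) (hw : ∀ r, r ≠ l → a r v = 0) :
    (SignType.sign (triple u v (ξ : E3)) : ℤ) = SignType.sign D * (pairCoeff k l *
      -((SignType.sign (a k u) : ℤ) * (SignType.sign (a l v) : ℤ))) := by
  have h : triple u v (ξ : E3) = D * (((-pairCoeff k l : ℤ) : ℝ) * (a k u * a l v)) := by
    rw [hD]
    simp only [haξ]
    fin_cases k <;> fin_cases l <;> simp_all [pairCoeff, Fin.forall_fin_succ]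
  have hs : ∀ z : ℤ, z = -1 ∨ z = 0 ∨ z = 1 → (SignType.sign (z : ℝ) : ℤ) = z := by
    rintro z (rfl | rfl | rfl) <;> simp
  rw [h, sign_mul, sign_mul, sign_mul]
  have := hs (-pairCoeff k l) (by revert k l; simp only [pairCoeff]; intros; split_ifs <;> simp)
  rw [SignType.coe_mul, SignType.coe_mul, SignType.coe_mul, this]
  ring

/-- The Tait number in a direction with positive coordinates does not depend on the direction. -/
theorem tait_eq_sum (hv : K.IsVertexFree ξ) (haξ : ∀ k, a k ξ = 1)
    (hinj : ∀ x, (∀ k, a k x = 0) → x = 0)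
    (hD : ∀ u v w, triple u v w = D * (a 0 u * (a 1 v * a 2 w - a 2 v * a 1 w) -
      a 1 u * (a 0 v * a 2 w - a 2 v * a 0 w) + a 2 u * (a 0 v * a 1 w - a 1 v * a 0 w)))
    (hκ : ∀ i k, k ≠ κ i → a k (K.edgeVec i) = 0) (hκ' : ∀ i, a (κ i) (K.edgeVec i) ≠ 0) :
    K.tait ξ = SignType.sign D * ∑ i, ∑ j, residueCoeff (κ i) (κ j) *
      doubleDiff posIndicator (fun i k => a k (K.vertex i)) i j := by
  classical
  have hκe : ∀ i k, k ≠ κ i → a k (K.vertex (i + 1)) = a k (K.vertex i) := fun i k h => by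
    have := hκ i k h
    rwa [edgeVec, map_sub, sub_eq_zero] at this
  rw [← sum_pairCoeff_mul_doubleDiff]
  have hcoef : ∀ k, pairCoeff k k = 0 := by decide
  have hsign : ∀ i j, (SignType.sign (triple (K.edgeVec i) (K.edgeVec j) (ξ : E3)) : ℤ) =
      SignType.sign D * (pairCoeff (κ i) (κ j) * -((SignType.sign (a (κ i) (K.edgeVec i)) : ℤ) *
        (SignType.sign (a (κ j) (K.edgeVec j)) : ℤ))) := fun i j =>
    sign_triple_edgeVec haξ hD (hκ i) (hκ j)
  -- Crossings of parallel edges have sign 0 and can be dropped.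
  have h1 : K.tait ξ = ∑ᶠ c ∈ {c | c ∈ K.crossings ξ ∧ κ c.1.1 ≠ κ c.2.1}, K.crossingSign ξ c := by
    refine finsum_mem_inter_support_eq' _ _ _ fun c hc => ⟨fun h => ⟨h, fun he => hc ?_⟩, And.left⟩
    rw [crossingSign, hsign, he, hcoef]; simp
  -- An ordered pair of edges along different axes has at most one crossing, so the sum may run over
  -- pairs.
  have h2 : K.tait ξ = ∑ᶠ q ∈ ((Finset.univ.filter fun q : Fin n × Fin n => κ q.1 ≠ κ q.2 ∧
      ∃ t u, ((q.1, t), (q.2, u)) ∈ K.crossings ξ : Finset (Fin n × Fin n)) : Set (Fin n × Fin n)),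
      (SignType.sign (triple (K.edgeVec q.1) (K.edgeVec q.2) (ξ : E3)) : ℤ) := by
    rw [h1]
    refine finsum_mem_eq_of_bijOn (fun c => (c.1.1, c.2.1)) ⟨?_, ?_, ?_⟩ fun c _ => rfl
    · rintro ⟨⟨i, t⟩, ⟨j, u⟩⟩ ⟨hc, hne⟩
      simp only [Finset.coe_filter, Finset.mem_univ, true_and, mem_ofPred_eq]
      exact ⟨hne, t, u, hc⟩
    · rintro ⟨⟨i, t⟩, ⟨j, u⟩⟩ ⟨hc, hne⟩ ⟨⟨i', t'⟩, ⟨j', u'⟩⟩ ⟨hc', -⟩ he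
      obtain ⟨rfl, rfl⟩ := Prod.mk_inj.1 he
      obtain ⟨m1, m2⟩ := thirdIndex_ne _ _ hne
      obtain ⟨-, ht, hu⟩ := (hit_iff haξ hinj hκe hne m1 m2 t u).1 hc
      obtain ⟨-, ht', hu'⟩ := (hit_iff haξ hinj hκe hne m1 m2 t' u').1 hc'
      have e1 := hκ' i
      have e2 := hκ' j
      rw [edgeVec, map_sub] at e1 e2
      have et : (t : ℝ) = t' := mul_right_cancel₀ e1 (by linarith)
      have eu : (u : ℝ) = u' := mul_right_cancel₀ (neg_ne_zero.2 e2) (by linarith)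
      rw [Subtype.ext et, Subtype.ext eu]
    · rintro ⟨i, j⟩ hq
      simp only [Finset.coe_filter, Finset.mem_univ, true_and, mem_ofPred_eq] at hq
      obtain ⟨hne, t, u, hc⟩ := hq
      exact ⟨((i, t), (j, u)), ⟨hc, hne⟩, rfl⟩
  rw [h2, finsum_mem_coe_finset, Finset.sum_filter, Fintype.sum_prod_type, Finset.mul_sum]
  refine Finset.sum_congr rfl fun i _ => ?_
  rw [Finset.mul_sum]
  refine Finset.sum_congr rfl fun j _ => ?_
  by_cases hij : κ i = κ j
  · simp [hij, hcoef]
  · rw [pairCoeff_mul_doubleDiff hv haξ hinj hκe hij, hsign]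
    simp only [hij, ne_eq, not_false_eq_true, true_and]
    split_ifs <;> simp

end Coordinates

end PLKnot

/-! ### Axis coordinates of a lattice knot and constancy on an octant -/

theorem triple_eq_mul_det (b : OrthonormalBasis (Fin 3) ℝ E3) (u v w : E3) :
    triple u v w = triple (b 0) (b 1) (b 2) *
      (⟪b 0, u⟫ * (⟪b 1, v⟫ * ⟪b 2, w⟫ - ⟪b 2, v⟫ * ⟪b 1, w⟫) -
        ⟪b 1, u⟫ * (⟪b 0, v⟫ * ⟪b 2, w⟫ - ⟪b 2, v⟫ * ⟪b 0, w⟫) +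
        ⟪b 2, u⟫ * (⟪b 0, v⟫ * ⟪b 1, w⟫ - ⟪b 1, v⟫ * ⟪b 0, w⟫)) := by
  have hc : ∀ x : E3, ∀ r, x r = ⟪b 0, x⟫ * b 0 r + ⟪b 1, x⟫ * b 1 r + ⟪b 2, x⟫ * b 2 r := by
    intro x r
    conv_lhs => rw [← b.sum_repr' x]
    simp [Fin.sum_univ_three]
  have hM : Matrix.of ![u.ofLp, v.ofLp, w.ofLp] =
      Matrix.of ![![⟪b 0, u⟫, ⟪b 1, u⟫, ⟪b 2, u⟫], ![⟪b 0, v⟫, ⟪b 1, v⟫, ⟪b 2, v⟫],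
        ![⟪b 0, w⟫, ⟪b 1, w⟫, ⟪b 2, w⟫]] *
      Matrix.of ![(b 0).ofLp, (b 1).ofLp, (b 2).ofLp] := by
    ext p q
    rw [Matrix.mul_apply, Fin.sum_univ_three]
    fin_cases p
    exacts [hc u q, hc v q, hc w q]
  rw [triple, hM, Matrix.det_mul, mul_comm, triple, Matrix.det_fin_three
    (Matrix.of ![![⟪b 0, u⟫, ⟪b 1, u⟫, ⟪b 2, u⟫], ![⟪b 0, v⟫, ⟪b 1, v⟫, ⟪b 2, v⟫],
        ![⟪b 0, w⟫, ⟪b 1, w⟫, ⟪b 2, w⟫]])]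
  congr 1
  simp
  ring

theorem eq_zero_of_inner_eq_zero (b : OrthonormalBasis (Fin 3) ℝ E3) {x : E3}
    (h : ∀ k, ⟪b k, x⟫ = 0) : x = 0 := by
  rw [← b.sum_repr' x]; simp [h]

theorem eq_smul_of_inner_eq_zero (b : OrthonormalBasis (Fin 3) ℝ E3) {x : E3} {k : Fin 3}
    (h : ∀ j, j ≠ k → ⟪b j, x⟫ = 0) : x = ⟪b k, x⟫ • b k := by
  conv_lhs => rw [← b.sum_repr' x]
  rw [Finset.sum_eq_single k (fun j _ hj => by rw [h j hj, zero_smul]) (by simp)]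

/-- The signs of the three coordinates in an octant. -/
def octantSign (σ : ℤˣ × ℤˣ) : Fin 3 → ℤˣ := ![σ.1, σ.2, 1]

theorem mem_octant_iff {b : OrthonormalBasis (Fin 3) ℝ E3} {σ : ℤˣ × ℤˣ} {ξ : S2} :
    ξ ∈ octant b σ ↔ ∀ k, 0 < ((octantSign σ k : ℤ) : ℝ) * ⟪b k, (ξ : E3)⟫ := by
  simp only [octant, octantSign, Fin.forall_fin_succ]
  simp
  tauto

/-- This invariance is what removes ξ from the final count. -/
theorem doubleDiff_posIndicator_congr {n : ℕ} [NeZero n] {p q : Fin n → Fin 3 → ℝ} {c : Fin 3 → ℝ}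
    (hc : ∀ k, 0 < c k) (h : ∀ i k, q i k = c k * p i k) (i j : Fin n) :
    doubleDiff posIndicator p i j = doubleDiff posIndicator q i j := by
  have : ∀ i j, posIndicator (p i - p j) = posIndicator (q i - q j) := fun i j => by
    simp only [posIndicator, Pi.sub_apply, h, ← mul_sub, mul_pos_iff_of_pos_left (hc _)]
  simp only [doubleDiff, this]

namespace PLKnot

variable {n : ℕ} [NeZero n] (K : PLKnot n)

/-- The edges of a lattice knot are parallel to the axes. -/
theorem exists_edge_axis {o : E3} {a : ℝ} {b : OrthonormalBasis (Fin 3) ℝ E3}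
    (hK : K.carrier ⊆ cubicGrid o a b) (i : Fin n) :
    ∃ k, ∀ j, j ≠ k → ⟪b j, K.edgeVec i⟫ = 0 := by
  have h : ∀ t : Ico (0 : ℝ) 1, ∃ q : Fin 3 × (Fin 3 → ℤ), ∀ j, j ≠ q.1 →
      ⟪b j, edgePoint K.vertex i t - o⟫ = q.2 j * a := fun t => by
    obtain ⟨k, hk⟩ := hK (K.edgePoint_mem_carrier i (Ico_subset_Icc_self t.2))
    choose! m hm using hk
    exact ⟨(k, m), hm⟩
  choose f hf using h
  -- The edge has uncountably many points but only countably many labels, so two points share one;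
  -- their difference is a multiple of the edge vector.
  have hinj : ¬ Function.Injective f := fun hi => by
    have : Countable (Ico (0 : ℝ) 1) := hi.countable
    exact (Cardinal.Real.Ico_countable_iff.1 (countable_coe_iff.1 this)).not_gt one_pos
  simp only [Function.Injective, not_forall] at hinj
  obtain ⟨t, u, hft, hne⟩ := hinj
  refine ⟨(f t).1, fun j hj => ?_⟩
  have h1 := hf t j hj
  have h2 := hf u j (hft ▸ hj)
  rw [← hft] at h2
  have h3 : edgePoint K.vertex i t - o - (edgePoint K.vertex i u - o) =
      ((t : ℝ) - u) • K.edgeVec i := by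
    simp only [edgePoint, edgeVec]
    module
  have h4 : ((t : ℝ) - u) * ⟪b j, K.edgeVec i⟫ = 0 := by
    rw [← real_inner_smul_right, ← h3, inner_sub_right, h1, h2, sub_self]
  exact (mul_eq_zero.1 h4).resolve_left (sub_ne_zero.2 fun h => hne (Subtype.ext h))

/-- A lattice knot assigns to each edge the index of the only axis it is not orthogonal to. -/
theorem exists_axes {o : E3} {a : ℝ} {b : OrthonormalBasis (Fin 3) ℝ E3}
    (hK : K.carrier ⊆ cubicGrid o a b) : ∃ κ : Fin n → Fin 3,
      (∀ i k, k ≠ κ i → ⟪b k, K.edgeVec i⟫ = 0) ∧ ∀ i, ⟪b (κ i), K.edgeVec i⟫ ≠ 0 := by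
  choose κ hκ using K.exists_edge_axis hK
  refine ⟨κ, hκ, fun i h => K.edgeVec_ne_zero i (eq_zero_of_inner_eq_zero b fun k => ?_)⟩
  by_cases hk : k = κ i
  · rw [hk, h]
  · exact hκ i k hk

theorem tait_eq_of_mem_octant {b : OrthonormalBasis (Fin 3) ℝ E3} {κ : Fin n → Fin 3}
    (hκ : ∀ i k, k ≠ κ i → ⟪b k, K.edgeVec i⟫ = 0) (hκ' : ∀ i, ⟪b (κ i), K.edgeVec i⟫ ≠ 0)
    {σ : ℤˣ × ℤˣ} {ξ : S2} (hξ : ξ ∈ octant b σ) (hv : K.IsVertexFree ξ) :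
    K.tait ξ = SignType.sign (triple (b 0) (b 1) (b 2)) * (σ.1 * σ.2) *
      ∑ i, ∑ j, residueCoeff (κ i) (κ j) * doubleDiff posIndicator
        (fun i k => ((octantSign σ k : ℤ) : ℝ) * ⟪b k, K.vertex i⟫) i j := by
  rw [mem_octant_iff] at hξ
  have hne : ∀ k, ⟪b k, (ξ : E3)⟫ ≠ 0 := fun k h => by simpa [h] using hξ k
  let a : Fin 3 → E3 →ₗ[ℝ] ℝ := fun k => (⟪b k, (ξ : E3)⟫⁻¹) • innerₛₗ ℝ (b k)
  have ha : ∀ k x, a k x = ⟪b k, (ξ : E3)⟫⁻¹ * ⟪b k, x⟫ := fun k x => rfl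
  have ha' : ∀ k x, ⟪b k, x⟫ = ⟪b k, (ξ : E3)⟫ * a k x := fun k x => by
    rw [ha, mul_inv_cancel_left₀ (hne k)]
  have hs : ∀ k, (SignType.sign ⟪b k, (ξ : E3)⟫ : ℤ) = octantSign σ k := fun k => by
    have := hξ k
    rcases Int.units_eq_one_or (octantSign σ k) with h | h
    · rw [h] at this ⊢
      rw [sign_pos (by simpa using this)]; rfl
    · rw [h] at this ⊢
      rw [sign_neg (by simpa using this)]; rfl
  rw [tait_eq_sum (K := K) (ξ := ξ) (a := a) (κ := κ)
    (D := triple (b 0) (b 1) (b 2) * (⟪b 0, (ξ : E3)⟫ * ⟪b 1, (ξ : E3)⟫ * ⟪b 2, (ξ : E3)⟫)) hv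
    (fun k => by rw [ha, inv_mul_cancel₀ (hne k)])
    (fun x h => eq_zero_of_inner_eq_zero b fun k => by rw [ha', h, mul_zero])
    (fun u v w => by
      rw [triple_eq_mul_det b, ha' 0 u, ha' 1 u, ha' 2 u, ha' 0 v, ha' 1 v, ha' 2 v, ha' 0 w,
        ha' 1 w, ha' 2 w]
      ring)
    (fun i k h => by rw [ha, hκ i k h, mul_zero])
    (fun i => by rw [ha]; exact mul_ne_zero (inv_ne_zero (hne _)) (hκ' i))]
  congr 1
  · rw [sign_mul, sign_mul, sign_mul, SignType.coe_mul, SignType.coe_mul, SignType.coe_mul, hs, hs,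
      hs]
    simp [octantSign]
  · refine Finset.sum_congr rfl fun i _ => Finset.sum_congr rfl fun j _ => ?_
    -- The scaling factor is the absolute value of the k-th coordinate of ξ, positive in the octant.
    rw [doubleDiff_posIndicator_congr hξ (q := fun i k => ((octantSign σ k : ℤ) : ℝ) *
      ⟪b k, K.vertex i⟫) fun i k => ?_]
    rw [mul_assoc, ← ha']

/-- Two consecutive edges use at most two axes, so some axis is orthogonal to the whole arc. -/
theorem indicatrix_subset {b : OrthonormalBasis (Fin 3) ℝ E3} {κ : Fin n → Fin 3}
    (hκ : ∀ i k, k ≠ κ i → ⟪b k, K.edgeVec i⟫ = 0) : K.indicatrix ⊆ axisCircles b := by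
  have h : ∀ ξ : S2, ∀ i, ξ ∈ K.indicatrixArc i → ξ ∈ axisCircles b := by
    rintro ξ i ⟨α, β, -, -, h⟩
    obtain ⟨k, h1, h2⟩ : ∃ k, k ≠ κ i ∧ k ≠ κ (i + 1) := by
      generalize κ i = x
      generalize κ (i + 1) = y
      revert x y; decide
    refine ⟨k, ?_⟩
    rw [h, inner_add_right, real_inner_smul_right, real_inner_smul_right, edgeDir, edgeDir,
      real_inner_smul_right, real_inner_smul_right, hκ _ k h1, hκ _ k h2]
    simp
  rintro ξ ⟨i, hi | hi⟩
  · exact h ξ i hi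
  · obtain ⟨k, hk⟩ := h _ i hi
    exact ⟨k, by simpa using hk⟩

end PLKnot

/-! ### Null sets of directions -/

/-- Spherical area is a multiple of the volume of the truncated cone over the set, so a null cone
meets the sphere in a null set. -/
theorem sphereArea_preimage_eq_zero {N : Set E3} (hN : MeasurableSet N) (h0 : volume N = 0)
    (hc : ∀ x ∈ N, ∀ r : ℝ, r • x ∈ N) : sphereArea ((↑) ⁻¹' N : Set S2) = 0 := by
  rw [sphereArea, Measure.toSphere_apply' _ (measurable_subtype_coe hN)]
  refine mul_eq_zero_of_right _ (measure_mono_null ?_ h0)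
  rintro _ ⟨r, -, _, ⟨ξ, hξ, rfl⟩, rfl⟩
  exact hc _ hξ r

theorem ae_notMem_submodule {p : Submodule ℝ E3} (hp : p ≠ ⊤) :
    ∀ᵐ ξ : S2 ∂sphereArea, (ξ : E3) ∉ p := by
  have := sphereArea_preimage_eq_zero (N := (p : Set E3)) p.closed_of_finiteDimensional.measurableSet
    (Measure.addHaar_submodule volume p hp) (fun x hx r => p.smul_mem r hx)
  rw [ae_iff]
  simp only [not_not]
  exact this

theorem span_pair_ne_top (x y : E3) : Submodule.span ℝ {x, y} ≠ ⊤ := by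
  intro h
  have h1 : Module.finrank ℝ (Submodule.span ℝ {x, y}) ≤ 2 := by
    classical
    have := finrank_span_finset_le_card (R := ℝ) ({x, y} : Finset E3)
    simp only [Finset.coe_insert, Finset.coe_singleton] at this
    exact this.trans Finset.card_le_two
  rw [h, finrank_top, finrank_euclideanSpace_fin] at h1
  omega

theorem orthogonal_basis_ne_top (b : OrthonormalBasis (Fin 3) ℝ E3) (k : Fin 3) :
    (innerₛₗ ℝ (b k)).ker ≠ ⊤ := by
  intro h
  have : b k ∈ (innerₛₗ ℝ (b k)).ker := h ▸ Submodule.mem_top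
  simp at this

theorem ae_notMem_axisCircles (b : OrthonormalBasis (Fin 3) ℝ E3) :
    ∀ᵐ ξ : S2 ∂sphereArea, ξ ∉ axisCircles b := by
  have h : ∀ᵐ ξ : S2 ∂sphereArea, ∀ k, (ξ : E3) ∉ (innerₛₗ ℝ (b k)).ker :=
    ae_all_iff.2 fun k => ae_notMem_submodule (orthogonal_basis_ne_top b k)
  filter_upwards [h] with ξ hξ
  rintro ⟨k, hk⟩
  exact hξ k hk

/-- The zeros of a nonzero quadratic form without squares of coordinates form a null set. -/
theorem ae_quadric_ne_zero (b : OrthonormalBasis (Fin 3) ℝ E3) {r s q : Fin 3}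
    (hrq : r ≠ q) (hsq : s ≠ q) (A B : ℝ) {C : ℝ} (hC : C ≠ 0) :
    ∀ᵐ ξ : S2 ∂sphereArea, A * ⟪b s, (ξ : E3)⟫ * ⟪b q, (ξ : E3)⟫ - B * ⟪b r, (ξ : E3)⟫ *
      ⟪b q, (ξ : E3)⟫ + C * ⟪b r, (ξ : E3)⟫ * ⟪b s, (ξ : E3)⟫ ≠ 0 := by
  let Q : E3 → ℝ := fun x => A * ⟪b s, x⟫ * ⟪b q, x⟫ - B * ⟪b r, x⟫ * ⟪b q, x⟫ +
    C * ⟪b r, x⟫ * ⟪b s, x⟫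
  have hQ : Continuous Q := by fun_prop
  have hmeas : MeasurableSet {x | Q x ≠ 0} := (isOpen_ne_fun hQ continuous_const).measurableSet
  have hae : ∀ᵐ x : E3, x ∈ {x | Q x ≠ 0} := by
    rw [← ae_ae_add_linearMap_mem_iff (LinearMap.toSpanSingleton ℝ E3 (b q)) volume volume hmeas]
    have hker : ∀ k, ∀ᵐ x : E3, x ∉ (innerₛₗ ℝ (b k)).ker := fun k => by
      rw [ae_iff]
      simp only [not_not]
      exact Measure.addHaar_submodule volume _ (orthogonal_basis_ne_top b k)
    filter_upwards [hker r, hker s] with y hr hs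
    replace hr : ⟪b r, y⟫ ≠ 0 := hr
    replace hs : ⟪b s, y⟫ ≠ 0 := hs
    have hQt : ∀ t : ℝ, Q (y + t • b q) = (A * ⟪b s, y⟫ - B * ⟪b r, y⟫) * (⟪b q, y⟫ + t) +
        C * ⟪b r, y⟫ * ⟪b s, y⟫ := fun t => by
      simp only [Q, inner_add_right, real_inner_smul_right, b.inner_eq_zero hrq,
        b.inner_eq_zero hsq, b.inner_eq_one]
      ring
    refine (measure_mono_null (t := {-(C * ⟪b r, y⟫ * ⟪b s, y⟫) /
      (A * ⟪b s, y⟫ - B * ⟪b r, y⟫) - ⟪b q, y⟫}) ?_ Real.volume_singleton)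
    intro t ht
    have ht : Q (y + t • b q) = 0 := by simpa using ht
    rw [hQt] at ht
    have hne : A * ⟪b s, y⟫ - B * ⟪b r, y⟫ ≠ 0 := fun h => by
      rw [h, zero_mul, zero_add] at ht
      exact mul_ne_zero (mul_ne_zero hC hr) hs ht
    rw [mem_singleton_iff, eq_sub_iff_add_eq, eq_div_iff hne]
    linarith
  have h0 : volume {x | Q x = 0} = 0 := by
    rw [ae_iff] at hae
    simpa using hae
  have := sphereArea_preimage_eq_zero (isClosed_eq hQ continuous_const).measurableSet h0
    (fun x hx t => by
      have : Q (t • x) = t ^ 2 * Q x := by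
        simp only [Q, real_inner_smul_right]; ring
      rw [mem_ofPred_eq] at hx ⊢
      rw [this, hx, mul_zero])
  rw [ae_iff]
  simpa using this

/-! ### Almost every direction is good -/

namespace PLKnot

variable {n : ℕ} [NeZero n] (K : PLKnot n)

theorem exists_eq_vertex_add_smul {x : E3} (hx : x ∈ K.carrier) :
    ∃ i, ∃ t : ℝ, x = K.vertex i + t • K.edgeVec i := by
  obtain ⟨⟨i, t⟩, rfl⟩ := hx
  exact ⟨i, t, rfl⟩

theorem isVertexFree_of_notMem_span {ξ : S2}
    (h : ∀ i j, (ξ : E3) ∉ Submodule.span ℝ {K.vertex j - K.vertex i, K.edgeVec j}) :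
    K.IsVertexFree ξ := by
  rintro i x hx ⟨r, hr⟩
  obtain ⟨j, t, rfl⟩ := K.exists_eq_vertex_add_smul hx
  by_cases h0 : r = 0
  · rwa [h0, zero_smul, sub_eq_zero] at hr
  refine (h i j (Submodule.mem_span_pair.2 ⟨r⁻¹, r⁻¹ * t, ?_⟩)).elim
  rw [mul_smul, ← smul_add, sub_add_eq_add_sub, hr, inv_smul_smul₀ h0]

theorem ae_isGood {b : OrthonormalBasis (Fin 3) ℝ E3} {κ : Fin n → Fin 3}
    (hκ : ∀ i k, k ≠ κ i → ⟪b k, K.edgeVec i⟫ = 0) (hκ' : ∀ i, ⟪b (κ i), K.edgeVec i⟫ ≠ 0) :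
    ∀ᵐ ξ : S2 ∂sphereArea, K.IsGood ξ := by
  have h1 : ∀ᵐ ξ : S2 ∂sphereArea, ∀ i j,
      (ξ : E3) ∉ Submodule.span ℝ {K.vertex j - K.vertex i, K.edgeVec j} :=
    ae_all_iff.2 fun i => ae_all_iff.2 fun j => ae_notMem_submodule (span_pair_ne_top _ _)
  -- If points on the edges i, j, k lie at heights 0, l, m on a line along ξ, the three constants
  -- are m - l, m and l times the coordinates of ξ along the axes of i, j and k. The form then
  -- vanishes because (m - l) - m + l = 0.
  have h2 : ∀ᵐ ξ : S2 ∂sphereArea, ∀ i j k, κ i ≠ κ j → κ i ≠ κ k → κ j ≠ κ k →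
      ⟪b (κ k), K.vertex j - K.vertex i⟫ ≠ 0 →
      ⟪b (κ i), K.vertex k - K.vertex j⟫ * ⟪b (κ j), (ξ : E3)⟫ * ⟪b (κ k), (ξ : E3)⟫ -
        ⟪b (κ j), K.vertex k - K.vertex i⟫ * ⟪b (κ i), (ξ : E3)⟫ * ⟪b (κ k), (ξ : E3)⟫ +
        ⟪b (κ k), K.vertex j - K.vertex i⟫ * ⟪b (κ i), (ξ : E3)⟫ * ⟪b (κ j), (ξ : E3)⟫ ≠ 0 := by
    refine ae_all_iff.2 fun i => ae_all_iff.2 fun j => ae_all_iff.2 fun k => ?_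
    simp only [Filter.eventually_imp_distrib_left]
    intro hij hik hjk hC
    exact ae_quadric_ne_zero b hik hjk _ _ hC
  filter_upwards [h1, h2, ae_notMem_axisCircles b] with ξ h1 h2 h3
  have hne : ∀ k, ⟪b k, (ξ : E3)⟫ ≠ 0 := fun k hk => h3 ⟨k, hk⟩
  -- Two points in line on parallel edges would put ξ in the plane through both edges, excluded by
  -- `h1`.
  have hpar : ∀ i j, ∀ t u : ℝ, κ i = κ j →
      K.vertex i + t • K.edgeVec i ≠ K.vertex j + u • K.edgeVec j →
      ∀ r : ℝ, K.vertex j + u • K.edgeVec j - (K.vertex i + t • K.edgeVec i) ≠ r • (ξ : E3) := by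
    intro i j t u hij hxy r hr
    have h0 : r ≠ 0 := fun h0 => hxy (by rw [h0, zero_smul, sub_eq_zero] at hr; exact hr.symm)
    have hi := eq_smul_of_inner_eq_zero b (hκ i)
    have hj := eq_smul_of_inner_eq_zero b (hκ j)
    have hij' : K.edgeVec i =
        (⟪b (κ i), K.edgeVec i⟫ / ⟪b (κ j), K.edgeVec j⟫) • K.edgeVec j := by
      conv_lhs => rw [hi]
      conv_rhs => rw [hj]
      rw [inner_smul_right, b.inner_eq_one, mul_one, smul_smul, hij, div_mul_cancel₀ _ (hκ' j)]
    refine h1 i j (Submodule.mem_span_pair.2 ⟨r⁻¹, r⁻¹ * (u - t * (⟪b (κ i), K.edgeVec i⟫ /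
      ⟪b (κ j), K.edgeVec j⟫)), ?_⟩)
    rw [mul_smul, ← smul_add, sub_smul, mul_smul, ← hij', eq_comm, ← inv_smul_smul₀ h0 (ξ : E3),
      ← hr]
    congr 1
    abel
  refine K.isGood_of_not_triple (K.isVertexFree_of_notMem_span h1) ?_
  intro x hx y hy z hz hxy hxz hyz hyx hzx
  obtain ⟨i, t, rfl⟩ := K.exists_eq_vertex_add_smul hx
  obtain ⟨j, u, rfl⟩ := K.exists_eq_vertex_add_smul hy
  obtain ⟨k, w, rfl⟩ := K.exists_eq_vertex_add_smul hz
  obtain ⟨l, hl⟩ := hyx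
  obtain ⟨m, hm⟩ := hzx
  have hml : K.vertex k + w • K.edgeVec k - (K.vertex j + u • K.edgeVec j) =
      (m - l) • (ξ : E3) := by
    rw [sub_smul, ← hl, ← hm]; abel
  have hij : κ i ≠ κ j := fun h => hpar i j t u h hxy l hl
  have hik : κ i ≠ κ k := fun h => hpar i k t w h hxz m hm
  have hjk : κ j ≠ κ k := fun h => hpar j k u w h hyz _ hml
  have hl0 : l ≠ 0 := fun h => hxy (by rw [h, zero_smul, sub_eq_zero] at hl; exact hl.symm)
  have e1 := congrArg (fun x => ⟪b (κ k), x⟫) hl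
  have e2 := congrArg (fun x => ⟪b (κ j), x⟫) hm
  have e3 := congrArg (fun x => ⟪b (κ i), x⟫) hml
  simp only [inner_sub_right, inner_add_right, real_inner_smul_right, hκ _ _ hij, hκ _ _ hik,
    hκ _ _ hjk, hκ _ _ hij.symm, hκ _ _ hik.symm, hκ _ _ hjk.symm, mul_zero, add_zero]
    at e1 e2 e3
  have h := h2 i j k hij hik hjk
  simp only [inner_sub_right, e1, e2, e3] at h
  exact h (mul_ne_zero hl0 (hne _)) (by ring)

end PLKnot

/-! ### Octants -/

/-- The open octant of the sphere given by three signs. -/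
def signOctant (b : OrthonormalBasis (Fin 3) ℝ E3) (s : Fin 3 → ℤˣ) : Set S2 :=
  {ξ | ∀ k, 0 < ((s k : ℤ) : ℝ) * ⟪b k, (ξ : E3)⟫}

theorem octant_eq_signOctant (b : OrthonormalBasis (Fin 3) ℝ E3) (σ : ℤˣ × ℤˣ) :
    octant b σ = signOctant b (octantSign σ) := Set.ext fun _ => mem_octant_iff

theorem isOpen_signOctant (b : OrthonormalBasis (Fin 3) ℝ E3) (s : Fin 3 → ℤˣ) :
    IsOpen (signOctant b s) := by
  have : signOctant b s = ⋂ k, {ξ : S2 | 0 < ((s k : ℤ) : ℝ) * ⟪b k, (ξ : E3)⟫} := by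
    ext; simp [signOctant]
  rw [this]
  exact isOpen_iInter_of_finite fun k => isOpen_lt continuous_const (by fun_prop)

theorem pairwise_disjoint_signOctant (b : OrthonormalBasis (Fin 3) ℝ E3) :
    Pairwise fun s s' => Disjoint (signOctant b s) (signOctant b s') := by
  intro s s' hne
  rw [Set.disjoint_left]
  intro ξ h h'
  refine hne (funext fun k => ?_)
  have h1 := h k
  have h2 := h' k
  rcases Int.units_eq_one_or (s k) with e | e <;> rcases Int.units_eq_one_or (s' k) with e' | e' <;>
    rw [e] at h1 ⊢ <;> rw [e'] at h2 ⊢ <;> norm_num at h1 h2 <;> linarith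

theorem exists_mem_signOctant {b : OrthonormalBasis (Fin 3) ℝ E3} {ξ : S2}
    (h : ξ ∉ axisCircles b) : ∃ s, ξ ∈ signOctant b s := by
  have : ∀ k, ∃ u : ℤˣ, 0 < ((u : ℤ) : ℝ) * ⟪b k, (ξ : E3)⟫ := fun k => by
    rcases lt_or_gt_of_ne (fun h0 => h ⟨k, h0⟩ : ⟪b k, (ξ : E3)⟫ ≠ 0) with h | h
    · exact ⟨-1, by simpa using h⟩
    · exact ⟨1, by simpa using h⟩
  choose s hs using this
  exact ⟨s, hs⟩

open scoped Pointwise in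
theorem Ioo_smul_signOctant (b : OrthonormalBasis (Fin 3) ℝ E3) (s : Fin 3 → ℤˣ) :
    Ioo (0 : ℝ) 1 • ((↑) '' signOctant b s : Set E3) =
      {x | ∀ k, 0 < ((s k : ℤ) : ℝ) * ⟪b k, x⟫} ∩ Metric.ball 0 1 := by
  ext x
  constructor
  · rintro ⟨r, hr, _, ⟨ξ, hξ, rfl⟩, rfl⟩
    refine ⟨fun k => ?_, ?_⟩
    · simp only [real_inner_smul_right]
      rw [mul_left_comm]
      exact mul_pos hr.1 (hξ k)
    · simp [norm_smul, abs_of_pos hr.1, hr.2]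
  · rintro ⟨hx, hx1⟩
    have hx0 : x ≠ 0 := fun h => by simpa [h] using hx 0
    have hn : 0 < ‖x‖ := norm_pos_iff.2 hx0
    refine ⟨‖x‖, ⟨hn, by simpa using hx1⟩, ‖x‖⁻¹ • x, ⟨⟨‖x‖⁻¹ • x, ?_⟩, fun k => ?_, rfl⟩,
      smul_inv_smul₀ hn.ne' x⟩
    · simp [norm_smul, hn.ne']
    · simp only [real_inner_smul_right]
      rw [mul_left_comm]
      exact mul_pos (inv_pos.2 hn) (hx k)

/-- The reflection that changes the signs of the coordinates. -/
noncomputable def signReflection (b : OrthonormalBasis (Fin 3) ℝ E3) (s : Fin 3 → ℤˣ) :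
    E3 ≃ₗᵢ[ℝ] E3 :=
  (b.repr.trans (LinearIsometryEquiv.piLpCongrRight 2 fun k =>
    if s k = 1 then LinearIsometryEquiv.refl ℝ ℝ else LinearIsometryEquiv.neg ℝ)).trans b.repr.symm

theorem inner_signReflection (b : OrthonormalBasis (Fin 3) ℝ E3) (s : Fin 3 → ℤˣ) (k : Fin 3)
    (x : E3) : ⟪b k, signReflection b s x⟫ = ((s k : ℤ) : ℝ) * ⟪b k, x⟫ := by
  rw [← b.repr_apply_apply, ← b.repr_apply_apply]
  simp only [signReflection, LinearIsometryEquiv.trans_apply, LinearIsometryEquiv.apply_symm_apply,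
    LinearIsometryEquiv.piLpCongrRight_apply]
  rcases Int.units_eq_one_or (s k) with h | h <;> simp [h]

theorem sphereArea_signOctant_eq (b : OrthonormalBasis (Fin 3) ℝ E3) (s : Fin 3 → ℤˣ) :
    sphereArea (signOctant b s) = sphereArea (signOctant b 1) := by
  rw [sphereArea, Measure.toSphere_apply' _ (isOpen_signOctant b s).measurableSet,
    Measure.toSphere_apply' _ (isOpen_signOctant b 1).measurableSet, Ioo_smul_signOctant,
    Ioo_smul_signOctant]
  congr 1
  have h := (signReflection b s).measurePreserving.measure_preimage_equiv
    (f := (signReflection b s).toHomeomorph.toMeasurableEquiv)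
    ({x | ∀ k, 0 < (((1 : Fin 3 → ℤˣ) k : ℤ) : ℝ) * ⟪b k, x⟫} ∩ Metric.ball 0 1)
  rw [← h]
  congr 1
  ext x
  simp [inner_signReflection]

theorem sphereArea_univ : sphereArea univ = ENNReal.ofReal (4 * Real.pi) := by
  rw [sphereArea, Measure.toSphere_apply_univ, EuclideanSpace.volume_ball_fin_three,
    finrank_euclideanSpace_fin, ENNReal.ofReal_one, one_pow, one_mul,
    ← ENNReal.ofReal_natCast, ← ENNReal.ofReal_mul (by norm_num)]
  congr 1
  push_cast
  ring

/-- Eight disjoint octants, congruent by reflections, fill the sphere of area 4π up to a null set.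
-/
theorem sphereArea_signOctant (b : OrthonormalBasis (Fin 3) ℝ E3) (s : Fin 3 → ℤˣ) :
    sphereArea (signOctant b s) = ENNReal.ofReal (Real.pi / 2) := by
  have h : sphereArea (⋃ s, signOctant b s) = sphereArea univ := by
    refine measure_congr (Filter.eventuallyEq_univ.2 ?_)
    filter_upwards [ae_notMem_axisCircles b] with ξ hξ
    exact mem_iUnion.2 (exists_mem_signOctant hξ)
  rw [measure_iUnion (pairwise_disjoint_signOctant b) fun s => (isOpen_signOctant b s).measurableSet,
    tsum_fintype, sphereArea_univ] at h
  simp only [sphereArea_signOctant_eq b] at h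
  rw [sphereArea_signOctant_eq]
  simp only [Finset.sum_const, Finset.card_univ, Fintype.card_pi, Fintype.card_units_int,
    Finset.prod_const, Fintype.card_fin, nsmul_eq_mul] at h
  have h8 : ENNReal.ofReal (4 * Real.pi) = ((2 ^ 3 : ℕ) : ENNReal) * ENNReal.ofReal (Real.pi / 2) := by
    rw [← ENNReal.ofReal_natCast, ← ENNReal.ofReal_mul (by positivity)]
    congr 1
    push_cast
    ring
  rw [h8] at h
  exact (ENNReal.mul_right_inj (by norm_num) (ENNReal.natCast_ne_top _)).1 h

/-- The octant is the radial projection of a convex cone that avoids the origin. -/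
theorem isPreconnected_signOctant (b : OrthonormalBasis (Fin 3) ℝ E3) (s : Fin 3 → ℤˣ) :
    IsPreconnected (signOctant b s) := by
  let C : Set E3 := {x | ∀ k, 0 < ((s k : ℤ) : ℝ) * ⟪b k, x⟫}
  have hC : Convex ℝ C := by
    intro x hx y hy α β hα hβ hαβ k
    simp only [inner_add_right, real_inner_smul_right]
    have h1 := hx k
    have h2 := hy k
    rcases hα.eq_or_lt with rfl | hα
    · obtain rfl : β = 1 := by linarith
      simpa using h2
    · nlinarith [mul_pos hα h1, mul_nonneg hβ h2.le]
  have hC0 : ∀ x ∈ C, x ≠ 0 := fun x hx h => by simpa [h] using hx 0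
  have : Subtype.val '' signOctant b s = (fun x : E3 => ‖x‖⁻¹ • x) '' C := by
    ext x
    constructor
    · rintro ⟨ξ, hξ, rfl⟩
      exact ⟨ξ, hξ, by simp⟩
    · rintro ⟨y, hy, rfl⟩
      have hn : 0 < ‖y‖ := norm_pos_iff.2 (hC0 y hy)
      refine ⟨⟨‖y‖⁻¹ • y, by simp [norm_smul, hn.ne']⟩, fun k => ?_, rfl⟩
      simp only [real_inner_smul_right]
      rw [mul_left_comm]
      exact mul_pos (inv_pos.2 hn) (hy k)
  rw [← Topology.IsInducing.subtypeVal.isPreconnected_image, this]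
  refine hC.isPreconnected.image _ (ContinuousOn.smul (continuousOn_id.norm.inv₀ fun x hx => ?_)
    continuousOn_id)
  exact norm_ne_zero_iff.2 (hC0 x hx)

theorem octantSign_injective : Function.Injective octantSign := by
  intro σ σ' h
  exact Prod.ext (congrFun h 0) (congrFun h 1)

theorem pairwise_disjoint_octant (b : OrthonormalBasis (Fin 3) ℝ E3) :
    Pairwise fun σ σ' => Disjoint (octant b σ) (octant b σ') := fun σ σ' h => by
  simp only [octant_eq_signOctant]
  exact pairwise_disjoint_signOctant b (octantSign_injective.ne h)

theorem hemisphere_sdiff_axisCircles (b : OrthonormalBasis (Fin 3) ℝ E3) :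
    hemisphere b \ axisCircles b = ⋃ σ, octant b σ := by
  ext ξ
  rw [mem_iUnion]
  constructor
  · rintro ⟨h, h'⟩
    obtain ⟨s, hs⟩ := exists_mem_signOctant h'
    exact ⟨(s 0, s 1), h, hs 0, hs 1⟩
  · rintro ⟨σ, hσ⟩
    refine ⟨hσ.1, ?_⟩
    rintro ⟨k, hk⟩
    have := mem_octant_iff.1 hσ k
    rw [hk, mul_zero] at this
    exact this.false

/-- The octants are connected, open and disjoint, so none can be joined to another inside their
union. -/
theorem connectedComponentIn_octant (b : OrthonormalBasis (Fin 3) ℝ E3) {σ : ℤˣ × ℤˣ} {ξ : S2}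
    (hξ : ξ ∈ octant b σ) :
    connectedComponentIn (hemisphere b \ axisCircles b) ξ = octant b σ := by
  have hsub : octant b σ ⊆ hemisphere b \ axisCircles b := by
    rw [hemisphere_sdiff_axisCircles]; exact subset_iUnion _ σ
  have hopen : ∀ σ, IsOpen (octant b σ) := fun σ => by
    rw [octant_eq_signOctant]; exact isOpen_signOctant b _
  refine Subset.antisymm ?_ (IsPreconnected.subset_connectedComponentIn
    (by rw [octant_eq_signOctant]; exact isPreconnected_signOctant b _) hξ hsub)
  refine isPreconnected_connectedComponentIn.subset_left_of_subset_union (hopen σ)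
    (isOpen_biUnion (s := {σ' | σ' ≠ σ}) fun σ' _ => hopen σ') ?_ ?_
    ⟨ξ, mem_connectedComponentIn (hsub hξ), hξ⟩
  · exact disjoint_iUnion₂_right.2 fun σ' h => pairwise_disjoint_octant b (Ne.symm h)
  · refine (connectedComponentIn_subset _ _).trans ?_
    rw [hemisphere_sdiff_axisCircles]
    refine iUnion_subset fun σ' => ?_
    by_cases h : σ' = σ
    · rw [h]; exact subset_union_left
    · exact (subset_biUnion_of_mem (u := fun σ => octant b σ) h).trans subset_union_right

/-! ### Integration of the Tait number over the sphere -/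

/-- An octant of the hemisphere together with the opposite one. -/
def doubleOctant (b : OrthonormalBasis (Fin 3) ℝ E3) (σ : ℤˣ × ℤˣ) : Set S2 :=
  signOctant b (octantSign σ) ∪ signOctant b (-octantSign σ)

theorem neg_mem_signOctant {b : OrthonormalBasis (Fin 3) ℝ E3} {s : Fin 3 → ℤˣ} {ξ : S2}
    (h : ξ ∈ signOctant b (-s)) : -ξ ∈ signOctant b s := fun k => by simpa using h k

theorem octantSign_ne_neg (σ σ' : ℤˣ × ℤˣ) : octantSign σ ≠ -octantSign σ' := fun h => by
  have h2 : (1 : ℤˣ) = -1 := congrFun h 2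
  exact absurd h2 (by decide)

theorem measurableSet_doubleOctant (b : OrthonormalBasis (Fin 3) ℝ E3) (σ : ℤˣ × ℤˣ) :
    MeasurableSet (doubleOctant b σ) :=
  (isOpen_signOctant b _).measurableSet.union (isOpen_signOctant b _).measurableSet

theorem pairwise_disjoint_doubleOctant (b : OrthonormalBasis (Fin 3) ℝ E3) :
    Pairwise fun σ σ' => Disjoint (doubleOctant b σ) (doubleOctant b σ') := fun σ σ' h => by
  have hd := pairwise_disjoint_signOctant b
  refine Disjoint.union_left (Disjoint.union_right ?_ ?_) (Disjoint.union_right ?_ ?_)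
  · exact hd (octantSign_injective.ne h)
  · exact hd (octantSign_ne_neg _ _)
  · exact hd (octantSign_ne_neg _ _).symm
  · exact hd (neg_injective.ne (octantSign_injective.ne h))

theorem sphereArea_real_doubleOctant (b : OrthonormalBasis (Fin 3) ℝ E3) (σ : ℤˣ × ℤˣ) :
    sphereArea.real (doubleOctant b σ) = Real.pi := by
  have hpi := Real.pi_pos
  rw [measureReal_def, doubleOctant, measure_union
    (pairwise_disjoint_signOctant b (octantSign_ne_neg σ σ)) (isOpen_signOctant b _).measurableSet,
    sphereArea_signOctant, sphereArea_signOctant, ← ENNReal.ofReal_add (by positivity)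
    (by positivity), ENNReal.toReal_ofReal (by positivity)]
  ring

theorem exists_mem_doubleOctant {b : OrthonormalBasis (Fin 3) ℝ E3} {ξ : S2}
    (h : ξ ∉ axisCircles b) : ∃ σ, ξ ∈ doubleOctant b σ := by
  obtain ⟨s, hs⟩ := exists_mem_signOctant h
  have h3 : ∀ s' : Fin 3 → ℤˣ, s' 2 = 1 → s' = octantSign (s' 0, s' 1) := fun s' h2 => by
    funext k
    fin_cases k <;> simp [octantSign, h2]
  rcases Int.units_eq_one_or (s 2) with h2 | h2
  · exact ⟨(s 0, s 1), Or.inl (h3 s h2 ▸ hs)⟩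
  · refine ⟨(-s 0, -s 1), Or.inr ?_⟩
    have := h3 (-s) (by simp [h2])
    simp only [Pi.neg_apply] at this
    rwa [← this, neg_neg]

theorem integral_sum_indicator_doubleOctant (b : OrthonormalBasis (Fin 3) ℝ E3)
    (τ : ℤˣ × ℤˣ → ℝ) :
    Integrable (fun ξ => ∑ σ, (doubleOctant b σ).indicator (fun _ => τ σ) ξ) sphereArea ∧
      ∫ ξ, ∑ σ, (doubleOctant b σ).indicator (fun _ => τ σ) ξ ∂sphereArea =
        Real.pi * ∑ σ, τ σ := by
  have hint : ∀ σ, Integrable ((doubleOctant b σ).indicator fun _ => τ σ) sphereArea := fun σ =>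
    (integrable_const _).indicator (measurableSet_doubleOctant b σ)
  refine ⟨integrable_finsetSum _ fun σ _ => hint σ, ?_⟩
  rw [integral_finsetSum _ fun σ _ => hint σ, Finset.mul_sum]
  refine Finset.sum_congr rfl fun σ _ => ?_
  rw [integral_indicator_const _ (measurableSet_doubleOctant b σ), sphereArea_real_doubleOctant,
    smul_eq_mul]

namespace PLKnot

variable {n : ℕ} [NeZero n] {K : PLKnot n}

theorem taitFun_ae_eq {b : OrthonormalBasis (Fin 3) ℝ E3} {τ : ℤˣ × ℤˣ → ℤ}
    (hgood : ∀ᵐ ξ ∂sphereArea, K.IsGood ξ)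
    (hτ : ∀ σ, ∀ ξ ∈ octant b σ, K.IsVertexFree ξ → K.tait ξ = τ σ) :
    K.taitFun =ᵐ[sphereArea]
      fun ξ => ∑ σ, (doubleOctant b σ).indicator (fun _ => (τ σ : ℝ)) ξ := by
  filter_upwards [hgood, ae_notMem_axisCircles b] with ξ hg hξ
  obtain ⟨σ, hσ⟩ := exists_mem_doubleOctant hξ
  have ht : K.tait ξ = τ σ := by
    rcases hσ with h | h
    · exact hτ σ ξ (by rwa [octant_eq_signOctant]) hg.isVertexFree
    · rw [← K.tait_neg]
      exact hτ σ (-ξ) (by rw [octant_eq_signOctant]; exact neg_mem_signOctant h)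
        hg.isVertexFree.neg
  rw [taitFun, if_pos hg, ht, Finset.sum_eq_single σ, indicator_of_mem hσ]
  · intro σ' _ hne
    exact indicator_of_notMem
      (Set.disjoint_left.1 (pairwise_disjoint_doubleOctant b hne.symm) hσ) _
  · simp

end PLKnot

theorem proposition5 {n : ℕ} [NeZero n] (K : PLKnot n)
    (o : E3) (a : ℝ) (ha : 0 < a) (b : OrthonormalBasis (Fin 3) ℝ E3)
    (hK : K.carrier ⊆ cubicGrid o a b) :
    -- the writhe is well defined, and four times the writhe is an integer
    (∀ᵐ ξ ∂sphereArea, K.IsGood ξ) ∧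
    Integrable K.taitFun sphereArea ∧
    (∃ m : ℤ, 4 * K.writhe = m) ∧
    -- the indicatrix runs on three great circles, which cut the hemisphere into four regions
    K.indicatrix ⊆ axisCircles b ∧
    hemisphere b \ axisCircles b = ⋃ σ, octant b σ ∧
    Pairwise (fun σ σ' => Disjoint (octant b σ) (octant b σ')) ∧
    (∀ σ, ∀ ξ ∈ octant b σ,
      connectedComponentIn (hemisphere b \ axisCircles b) ξ = octant b σ) ∧
    (∀ σ, sphereArea (octant b σ) = ENNReal.ofReal (Real.pi / 2)) ∧
    -- the Tait number is constant on each region, and the writhe is the average of the four values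
    ∃ τ : ℤˣ × ℤˣ → ℤ,
      (∀ σ, ∀ ξ ∈ octant b σ, K.IsGood ξ → K.tait ξ = τ σ) ∧
      K.writhe = (∑ σ, τ σ : ℤ) / 4 := by
  obtain ⟨κ, hκ, hκ'⟩ := K.exists_axes hK
  have hgood := K.ae_isGood hκ hκ'
  obtain ⟨τ, hτ⟩ : ∃ τ : ℤˣ × ℤˣ → ℤ,
      ∀ σ, ∀ ξ ∈ octant b σ, K.IsVertexFree ξ → K.tait ξ = τ σ :=
    ⟨_, fun σ ξ hξ hv => K.tait_eq_of_mem_octant hκ hκ' hξ hv⟩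
  have hae := PLKnot.taitFun_ae_eq hgood hτ
  obtain ⟨hint, hval⟩ := integral_sum_indicator_doubleOctant b fun σ => (τ σ : ℝ)
  have hw : K.writhe = (∑ σ, τ σ : ℤ) / 4 := by
    -- Each double octant has area π, and π / (4π) is the weight 1/4.
    rw [PLKnot.writhe, integral_congr_ae hae, hval]
    have := Real.pi_pos.ne'
    push_cast
    field_simp
  refine ⟨hgood, hint.congr hae.symm, ⟨∑ σ, τ σ, by rw [hw]; ring⟩, K.indicatrix_subset hκ,
    hemisphere_sdiff_axisCircles b, pairwise_disjoint_octant b,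
    fun σ ξ hξ => connectedComponentIn_octant b hξ,
    fun σ => by rw [octant_eq_signOctant, sphereArea_signOctant],
    τ, fun σ ξ hξ hg => hτ σ ξ hξ hg.isVertexFree, hw⟩
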